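/- Let $p$ be an odd prime, let $\mathbb{C}_p$ be the completion of an algebraic closure of $\mathbb{Q}_p$, and let $X=\mathbb{Z}_p\times\mathbb{Z}/(p-1)\mathbb{Z}$, in which each integer $k$ is identified with $(k,\,k \bmod (p-1))$. *Serre's family.* For an even integer $k\ge 4$ let $G_k=-\frac{B_k}{2k}+\sum_{n\ge1}\sigma_{k-1}(n)q^n$ be the $q$-expansion of the classical Eisenstein series. For $(s,u)\in X$ with $u$ even and $(s,u)\neq(0,0)$, Serre's $p$-adic Eisenstein series $G^*_{s,u}\in\mathbb{C}_p[[q]]$ is the limit of $G_{k_i}$, uniform in all coefficients, for every sequence of even integers $k_i\ge4$ with $k_i\to\infty$ (archimedean) and $k_i\to(s,u)$ in $X$. *The extended family.* Let $\omega$ be the Teichmüller character, regarded as a $\mathbb{C}_p$-valued Dirichlet character modulo $p$; $\omega^0$ is the trivial character modulo $p$. For $0\ne x\in\mathbb{Z}_p$ put $\langle x\rangle=p^{-v_p(x)}x/\hat x$, where $\hat x=\lim_n (p^{-v_p(x)}x)^{p^n}$, and $\langle x\rangle^s=\sum_{n\ge0}\binom{s}{n}(\langle x\rangle-1)^n$.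 Let $\chi$ be an even Dirichlet character modulo $p^v$, $v\ge1$, extended to $\mathbb{Z}_p$ (so $\chi$ vanishes on $p\mathbb{Z}_p$), let $x\in\mathbb{Z}_p$, and let $s\in\mathbb{C}_p$ with $|s|_p<p^{(p-2)/(p-1)}$. For $s\ne1$ put $$\zeta_p(s,\chi,x)=\frac1{s-1}\int_{\mathbb{Z}_p}\chi(x+a)\langle x+a\rangle^{1-s}\,da,\qquad \int_{\mathbb{Z}_p}f(a)\,da=\lim_{N\to\infty}\frac1{p^N}\sum_{a=0}^{p^N-1}f(a),$$ and let $\zeta_p(1,\chi,x)=\lim_{t\to1,\,t\ne1}\zeta_p(t,\chi,x)$ whenever this limit exists. Put $$a_0(s,\chi,x)=\tfrac12\zeta_p(1-s,\chi,x),\qquad a_n(s,\chi,x)=\int_{\mathbb{Z}_p}\chi(x+a)\langle x+a\rangle^{s}\,d\mu_n(a)\quad(n\ge1),$$ where $\mu_n=\sum_{d\mid n,\ (p,d)=1}d^{-1}\delta_d$, $\delta_d(U)=1$ if $d\in U$ and $0$ otherwise, and $\int f\,d\mu=\lim_{N}\sum_{a=0}^{p^N-1}f(a)\,\mu(a+p^N\mathbb{Z}_p)$.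 Let $G^*(s,\chi,x)=\sum_{n\ge0}a_n(s,\chi,x)q^n$. **Proposition.** For all $(s,u)\in\mathbb{Z}_p\times\mathbb{Z}/(p-1)\mathbb{Z}$ with $u$ even and $(s,u)\ne(0,0)$, Serre's series $G^*_{s,u}$ exists (sequences $k_i$ as above exist, and all of them give the same uniform limit), and $$G^*(s,\omega^u,0)=G^*_{s,u}.$$ -/

import Mathlib

open Filter Topology

noncomputable section

namespace PadicEisenstein

variable (p : ℕ) [Fact p.Prime]

/-- The inclusion `ℤ_p ⊆ ℚ_p ⊆ ℂ_p`. -/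
def toCp : ℤ_[p] →+* ℂ_[p] :=
  (algebraMap ℚ_[p] ℂ_[p]).comp PadicInt.Coe.ringHom

/-! ### The Teichmüller representative and the projection `⟨x⟩` -/

/-- The Teichmüller representative `lim x ^ (p ^ n)` of a `p`-adic integer `x`
(the `(p - 1)`-st root of unity congruent to `x` if `x` is a unit, and `0` if `p ∣ x`). -/
def teich (x : ℤ_[p]) : ℤ_[p] := limUnder atTop fun n : ℕ => x ^ p ^ n

variable {p}

theorem dvd_pow_sub_self (x : ℤ_[p]) : (p : ℤ_[p]) ∣ x ^ p - x := by
  rw [← Ideal.mem_span_singleton, ← PadicInt.maximalIdeal_eq_span_p, ← PadicInt.ker_toZMod,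
    RingHom.mem_ker]
  simp [ZMod.pow_card]

theorem norm_pow_sub_pow_le {x y : ℤ_[p]} (h : (p : ℤ_[p]) ∣ x - y) (n : ℕ) :
    ‖x ^ p ^ n - y ^ p ^ n‖ ≤ ((p : ℝ)⁻¹) ^ n := by
  have h1 : (p : ℤ_[p]) ^ n ∣ x ^ p ^ n - y ^ p ^ n :=
    (pow_dvd_pow _ n.le_succ).trans (dvd_sub_pow_of_dvd_sub h n)
  obtain ⟨c, hc⟩ := h1
  rw [hc, norm_mul, norm_pow, PadicInt.norm_p]
  exact mul_le_of_le_one_right (by positivity) (PadicInt.norm_le_one c)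

theorem inv_p_lt_one : (p : ℝ)⁻¹ < 1 :=
  inv_lt_one_of_one_lt₀ (by exact_mod_cast (Fact.out : p.Prime).one_lt)

theorem tendsto_teich (x : ℤ_[p]) :
    Tendsto (fun n : ℕ => x ^ p ^ n) atTop (𝓝 (teich p x)) := by
  refine CauchySeq.tendsto_limUnder (cauchySeq_of_le_geometric (p : ℝ)⁻¹ 1 inv_p_lt_one fun n => ?_)
  rw [dist_comm, dist_eq_norm, one_mul, pow_succ', pow_mul]
  exact norm_pow_sub_pow_le (dvd_pow_sub_self x) n

theorem teich_one : teich p 1 = 1 :=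
  tendsto_nhds_unique (tendsto_teich 1) (by simp)

theorem teich_mul (x y : ℤ_[p]) : teich p (x * y) = teich p x * teich p y :=
  tendsto_nhds_unique (tendsto_teich (x * y))
    (by simpa only [mul_pow] using (tendsto_teich x).mul (tendsto_teich y))

theorem teich_congr {x y : ℤ_[p]} (h : (p : ℤ_[p]) ∣ x - y) : teich p x = teich p y := by
  have h0 : Tendsto (fun n : ℕ => x ^ p ^ n - y ^ p ^ n) atTop (𝓝 0) :=
    squeeze_zero_norm (norm_pow_sub_pow_le h)
      (tendsto_pow_atTop_nhds_zero_of_lt_one (by positivity) inv_p_lt_one)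
  exact sub_eq_zero.mp
    (tendsto_nhds_unique ((tendsto_teich x).sub (tendsto_teich y)) h0)

theorem teich_zero : teich p 0 = 0 := by
  refine tendsto_nhds_unique (tendsto_teich 0) ?_
  have h (n : ℕ) : (0 : ℤ_[p]) ^ p ^ n = 0 :=
    zero_pow (pow_ne_zero n (Fact.out : p.Prime).ne_zero)
  simp [h]

theorem dvd_natCast_sub {a b : ℕ} (h : a ≡ b [MOD p ^ 1]) : (p : ℤ_[p]) ∣ (a : ℤ_[p]) - b := by
  rw [pow_one] at h
  obtain ⟨c, hc⟩ := h.symm.dvd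
  exact ⟨(c : ℤ_[p]), by exact_mod_cast congrArg (Int.cast : ℤ → ℤ_[p]) hc⟩

variable (p)

/-- The Teichmüller character `ω`, as a Dirichlet character modulo `p = p ^ 1` with values
in `ℂ_p`. -/
def omega : DirichletCharacter ℂ_[p] (p ^ 1) where
  toFun a := toCp p (teich p (a.val : ℤ_[p]))
  map_one' := by
    rw [teich_congr (y := 1), teich_one, map_one]
    have := dvd_natCast_sub (p := p) (a := (1 : ZMod (p ^ 1)).val) (b := 1)
      ((ZMod.natCast_eq_natCast_iff _ _ _).mp (by simp))
    simpa using this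
  map_mul' a b := by
    rw [teich_congr (y := (a.val : ℤ_[p]) * (b.val : ℤ_[p])), teich_mul, map_mul]
    have := dvd_natCast_sub (p := p) (a := (a * b).val) (b := a.val * b.val)
      ((ZMod.natCast_eq_natCast_iff _ _ _).mp (by simp))
    simpa using this
  map_nonunit' a ha := by
    have hp : p ∣ a.val := by
      by_contra h
      refine ha ((ZMod.isUnit_iff_coprime a.val (p ^ 1)).mpr ?_ |> fun h' => by simpa using h')
      exact Nat.Coprime.pow_right 1 ((Nat.Prime.coprime_iff_not_dvd Fact.out).mpr h).symm
    rw [teich_congr (y := 0), teich_zero, map_zero]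
    obtain ⟨c, hc⟩ := hp
    exact ⟨(c : ℤ_[p]), by rw [hc]; simp⟩

/-- The power `ω ^ u` for `u ∈ ℤ/(p-1)ℤ`; in particular `ω ^ 0` is the trivial character
modulo `p`, which vanishes on multiples of `p`. -/
def omegaPow (u : ZMod (p - 1)) : DirichletCharacter ℂ_[p] (p ^ 1) := omega p ^ u.val

/-- The unit part `x / p ^ v(x)` of a nonzero `p`-adic integer. -/
def unitPart (x : ℤ_[p]) : ℤ_[p] :=
  open Classical in if h : x = 0 then 1 else (PadicInt.unitCoeff h : ℤ_[p])

/-- The projection `⟨x⟩ = p ^ (-v(x)) * x / x̂` of a nonzero `p`-adic integer `x`, where `x̂` is the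
Teichmüller representative of the unit part of `x`. (The value at `x = 0` plays no role.) -/
def angle (x : ℤ_[p]) : ℂ_[p] := toCp p (unitPart p x) / toCp p (teich p (unitPart p x))

/-- `⟨x⟩ ^ s = ∑ n, (s choose n) (⟨x⟩ - 1) ^ n` for `s ∈ ℂ_p`; the series converges for
`|s| < p ^ ((p - 2) / (p - 1))`. -/
def anglePow (x : ℤ_[p]) (s : ℂ_[p]) : ℂ_[p] := ∑' n : ℕ, Ring.choose s n * (angle p x - 1) ^ n

/-- The extension to `ℤ_p` of a Dirichlet character modulo `p ^ v`. -/
def charEval {v : ℕ} (χ : DirichletCharacter ℂ_[p] (p ^ v)) (x : ℤ_[p]) : ℂ_[p] :=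
  χ (PadicInt.toZModPow v x)

/-! ### `p`-adic integrals -/

/-- The Volkenborn integral `∫ f(a) da = lim p ^ (-N) ∑_{a < p ^ N} f(a)`. -/
def volkenborn (f : ℤ_[p] → ℂ_[p]) : ℂ_[p] :=
  limUnder atTop fun N : ℕ => ((p : ℂ_[p]) ^ N)⁻¹ * ∑ a ∈ Finset.range (p ^ N), f (a : ℤ_[p])

/-- The `δ`-measure at `d`. -/
def delta (d : ℤ_[p]) (U : Set ℤ_[p]) : ℂ_[p] := open Classical in if d ∈ U then 1 else 0

/-- The measure `μ_n = ∑_{d ∣ n, (p, d) = 1} d⁻¹ δ_d`. -/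
def mu (n : ℕ) (U : Set ℤ_[p]) : ℂ_[p] :=
  ∑ d ∈ n.divisors with Nat.Coprime p d, (d : ℂ_[p])⁻¹ * delta p (d : ℤ_[p]) U

/-- The coset `a + p ^ N ℤ_p`. -/
def coset (a : ℤ_[p]) (N : ℕ) : Set ℤ_[p] := {z | (p : ℤ_[p]) ^ N ∣ z - a}

/-- The integral `∫ f dμ` of a continuous function against a `p`-adic measure, as the limit of
the Riemann sums `∑_{a < p ^ N} f(a) μ(a + p ^ N ℤ_p)`. -/
def measureIntegral (μ : Set ℤ_[p] → ℂ_[p]) (f : ℤ_[p] → ℂ_[p]) : ℂ_[p] :=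
  limUnder atTop fun N : ℕ =>
    ∑ a ∈ Finset.range (p ^ N), f (a : ℤ_[p]) * μ (coset p (a : ℤ_[p]) N)

/-! ### The extended family `G*(s, χ, x)`

Here `χ` is an even Dirichlet character modulo `p ^ v` with `v ≥ 1`, `x ∈ ℤ_p`, and
`s ∈ ℂ_p` with `|s| < p ^ ((p - 2) / (p - 1))`. -/

/-- `1 / (s - 1) * ∫ χ(x + a) ⟨x + a⟩ ^ (1 - s) da`, for `s ≠ 1`. -/
def hurwitzZetaAux {v : ℕ} (s : ℂ_[p]) (χ : DirichletCharacter ℂ_[p] (p ^ v)) (x : ℤ_[p]) :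
    ℂ_[p] :=
  1 / (s - 1) * volkenborn p fun a => charEval p χ (x + a) * anglePow p (x + a) (1 - s)

/-- The `p`-adic Hurwitz zeta function `ζ_p(s, χ, x)` for `x ∈ ℤ_p`. It is given by the Volkenborn
integral for `s ≠ 1`; at `s = 1` it is the limit for `s → 1`, `s ≠ 1`, whenever this exists
(removable singularity). -/
def hurwitzZeta {v : ℕ} (s : ℂ_[p]) (χ : DirichletCharacter ℂ_[p] (p ^ v)) (x : ℤ_[p]) : ℂ_[p] :=
  open Classical in
  if s = 1 then limUnder (𝓝[≠] (1 : ℂ_[p])) fun t => hurwitzZetaAux p t χ x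
  else hurwitzZetaAux p s χ x

/-- The coefficients `a_n(s, χ, x)`: `a_0 = ζ_p(1 - s, χ, x) / 2`, and
`a_n = ∫ χ(x + a) ⟨x + a⟩ ^ s dμ_n(a)` for `n ≥ 1`. -/
def familyCoeff {v : ℕ} (s : ℂ_[p]) (χ : DirichletCharacter ℂ_[p] (p ^ v)) (x : ℤ_[p]) (n : ℕ) :
    ℂ_[p] :=
  if n = 0 then 1 / 2 * hurwitzZeta p (1 - s) χ x
  else measureIntegral p (mu p n) fun a => charEval p χ (x + a) * anglePow p (x + a) s

/-- The `q`-expansion `G*(s, χ, x) = ∑_{n ≥ 0} a_n(s, χ, x) q ^ n`. -/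
def family {v : ℕ} (s : ℂ_[p]) (χ : DirichletCharacter ℂ_[p] (p ^ v)) (x : ℤ_[p]) :
    PowerSeries ℂ_[p] :=
  PowerSeries.mk (familyCoeff p s χ x)

/-! ### Serre's `p`-adic family of Eisenstein series -/

/-- The `q`-expansion `G_k = -B_k / (2k) + ∑_{n ≥ 1} σ_{k-1}(n) q ^ n` of the classical Eisenstein
series of weight `k`. -/
def classicalEisenstein (k : ℕ) : PowerSeries ℚ :=
  PowerSeries.mk fun n =>
    if n = 0 then -bernoulli k / (2 * k) else (ArithmeticFunction.sigma (k - 1) n : ℚ)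

variable {p} in
/-- `k 0, k 1, …` are even integers `≥ 4` which tend to infinity in the archimedean sense and
to `(s, u)` in the weight space `X = ℤ_p × ℤ/(p-1)ℤ`. -/
structure IsWeightSeq (s : ℤ_[p]) (u : ZMod (p - 1)) (k : ℕ → ℕ) : Prop where
  four_le : ∀ i, 4 ≤ k i
  even : ∀ i, Even (k i)
  tendsto_atTop : Tendsto k atTop atTop
  weight : Tendsto (fun i => ((k i : ℤ_[p]), (k i : ZMod (p - 1)))) atTop (𝓝 (s, u))

variable {p} in
/-- `f` is Serre's `p`-adic Eisenstein series of weight `(s, u)`: the weight `(s, u)` is a limit of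
classical weights, and whenever `k i → (s, u)` as above, the `q`-expansions of the classical
Eisenstein series `G_{k i}` converge to `f`, uniformly in all coefficients. -/
structure IsSerreEisenstein (s : ℤ_[p]) (u : ZMod (p - 1)) (f : PowerSeries ℂ_[p]) : Prop where
  exists_seq : ∃ k, IsWeightSeq s u k
  limit : ∀ k, IsWeightSeq s u k →
    TendstoUniformly
      (fun i n => ((PowerSeries.coeff n (classicalEisenstein (k i)) : ℚ) : ℂ_[p]))
      (fun n => PowerSeries.coeff n f) atTop

variable {p} in
theorem IsSerreEisenstein.unique {s : ℤ_[p]} {u : ZMod (p - 1)} {f g : PowerSeries ℂ_[p]}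
    (hf : IsSerreEisenstein s u f) (hg : IsSerreEisenstein s u g) : f = g := by
  obtain ⟨k, hk⟩ := hf.exists_seq
  ext n
  exact tendsto_nhds_unique ((hf.limit k hk).tendsto_at n) ((hg.limit k hk).tendsto_at n)

/-- Serre's `p`-adic Eisenstein series `G*_{s,u}`, the unique `q`-expansion satisfying
`IsSerreEisenstein s u` (if there is one). -/
def serreEisenstein (s : ℤ_[p]) (u : ZMod (p - 1)) : PowerSeries ℂ_[p] :=
  Classical.epsilon (IsSerreEisenstein s u)

end PadicEisenstein

end

namespace PadicEisenstein

/-! For `a` prime to `p` write `⟨a⟩ = 1 + p y(a)`, so that `ω^u(a)⟨a⟩^s = ∑ (s choose n) p^n ω^u(a)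
y(a)^n`. For `|s| ≤ 1` and `p` odd the coefficients decay geometrically, and the Volkenborn sums of
`ω^u y^n` converge with bounds independent of `n` (`norm_moment_le`, `tendsto_moment`). Hence the
integral is `V(s) = m₀ + s Q(s)`, with `Q` continuous on the unit ball (`volkenbornSeries_eq`), and
`ζ_p(1 - s) = -(m₀/s + Q(s))`. By orthogonality `m₀ = 0` when `u ≠ 0`, so the only possible pole is
at `(s, u) = (0, 0)`.

If `k ≡ u` modulo `p - 1`, then `ω^u(a)⟨a⟩^k = a^k` for `a` prime to `p`, whence `V(k) = (1 -
p^(k-1)) B_k` (`volkenbornSeries_natCast`). Along a weight sequence the Euler factor tends to 1, and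
continuity gives the constant term. In the higher coefficients the divisors prime to `p` contribute
`d⁻¹ ω^u(d)⟨d⟩^k`, close to the value at `s` uniformly in `d`; those divisible by `p` contribute at
most `p^(-(k-1))` in norm (`norm_sigma_sub_familyCoeff_le`). -/

theorem sum_range_mul_eq {M : Type*} [AddCommMonoid M] (f : ℕ → M) (n m : ℕ) :
    ∑ x ∈ Finset.range (n * m), f x =
      ∑ j ∈ Finset.range m, ∑ a ∈ Finset.range n, f (a + n * j) := by
  induction m with
  | zero => simp
  | succ m ih =>
    rw [Nat.mul_succ, Finset.sum_range_add, ih, Finset.sum_range_succ]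
    simp only [add_comm]

theorem sum_range_pow_succ_sub {R : Type*} [CommRing R] (p : ℕ) (f : ℕ → R) (N : ℕ) :
    ∑ x ∈ Finset.range (p ^ (N + 1)), f x - p * ∑ a ∈ Finset.range (p ^ N), f a =
      ∑ j ∈ Finset.range p, ∑ a ∈ Finset.range (p ^ N), (f (a + p ^ N * j) - f a) := by
  rw [pow_succ, sum_range_mul_eq]
  simp [Finset.sum_sub_distrib]

variable {p : ℕ} [Fact p.Prime]

/-! ### Divisibility of sums over `a < p^N`. -/

section Sums

theorem pow_dvd_sum_range {H : ℕ → ℤ_[p]}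
    (hH : ∀ N a j, (p : ℤ_[p]) ^ N ∣ p * (H (a + p ^ N * j) - H a)) (N : ℕ) :
    (p : ℤ_[p]) ^ N ∣ p ^ 2 * ∑ a ∈ Finset.range (p ^ N), H a := by
  induction N with
  | zero => simp
  | succ N ih =>
    have h : (p : ℤ_[p]) ^ 2 * ∑ a ∈ Finset.range (p ^ (N + 1)), H a =
        p * (p ^ 2 * ∑ a ∈ Finset.range (p ^ N), H a) +
        p * ∑ j ∈ Finset.range p, ∑ a ∈ Finset.range (p ^ N),
          p * (H (a + p ^ N * j) - H a) := by
      simp only [← Finset.mul_sum]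
      rw [← sum_range_pow_succ_sub]
      ring
    rw [h, pow_succ']
    exact dvd_add (mul_dvd_mul_left _ ih) (mul_dvd_mul_left _
      (Finset.dvd_sum fun j _ => Finset.dvd_sum fun a _ => hH N a j))

/-- Up to bounded powers of `p`, `H` is the derivative of `G`. The first-order terms carry `∑ j =
p(p-1)/2`, divisible by `p` because `p` is odd, and the sum of `H` supplies the remaining factor
`p^N`. -/
theorem pow_dvd_sum_range_succ_sub (hp : p ≠ 2) {G H : ℕ → ℤ_[p]}
    (hH : ∀ N a j, (p : ℤ_[p]) ^ N ∣ p * (H (a + p ^ N * j) - H a))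
    (hG : ∀ N a j, (p : ℤ_[p]) ^ (2 * N) ∣
      p ^ 2 * (G (a + p ^ N * j) - G a) - p ^ (N + 1) * j * H a) (N : ℕ) :
    (p : ℤ_[p]) ^ (2 * N) ∣ p ^ 2 * (∑ x ∈ Finset.range (p ^ (N + 1)), G x -
      p * ∑ a ∈ Finset.range (p ^ N), G a) := by
  obtain ⟨m, hm⟩ := (Fact.out : p.Prime).odd_of_ne_two hp
  have hj : ∑ j ∈ Finset.range p, (j : ℤ_[p]) = p * m := by
    have := Finset.sum_range_id_mul_two p
    have h2 : (∑ j ∈ Finset.range p, j) = p * m := by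
      have h3 : p - 1 = 2 * m := by omega
      rw [h3] at this
      linarith
    rw [← Nat.cast_sum, h2, Nat.cast_mul]
  have key : (p : ℤ_[p]) ^ 2 * (∑ x ∈ Finset.range (p ^ (N + 1)), G x -
      p * ∑ a ∈ Finset.range (p ^ N), G a) =
      ∑ j ∈ Finset.range p, ∑ a ∈ Finset.range (p ^ N),
        (p ^ 2 * (G (a + p ^ N * j) - G a) - p ^ (N + 1) * j * H a) +
      p ^ N * m * (p ^ 2 * ∑ a ∈ Finset.range (p ^ N), H a) := by
    simp only [Finset.sum_sub_distrib, ← Finset.mul_sum, sum_range_pow_succ_sub]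
    rw [← Finset.sum_mul, ← Finset.mul_sum, hj]
    ring
  rw [key, two_mul, pow_add]
  refine dvd_add (Finset.dvd_sum fun j _ => Finset.dvd_sum fun a _ => ?_) ?_
  · rw [← pow_add, ← two_mul]
    exact hG N a j
  · exact mul_dvd_mul (Dvd.intro _ rfl) (pow_dvd_sum_range hH N)

theorem pow_dvd_sum_range_of_succ_sub {G : ℕ → ℤ_[p]}
    (h : ∀ N, (p : ℤ_[p]) ^ (2 * N) ∣ p ^ 2 * (∑ x ∈ Finset.range (p ^ (N + 1)), G x -
      p * ∑ a ∈ Finset.range (p ^ N), G a)) (N : ℕ) :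
    (p : ℤ_[p]) ^ N ∣ p ^ 2 * ∑ a ∈ Finset.range (p ^ N), G a := by
  induction N with
  | zero => simp
  | succ N ih =>
    -- The exponent `2 * N` in `h` reaches `N + 1` only for `N ≥ 1`; for `N = 0` the factor `p^2`
    -- suffices.
    rcases N.eq_zero_or_pos with rfl | hN
    · simpa using Dvd.dvd.mul_right (dvd_pow_self (p : ℤ_[p]) two_ne_zero) _
    · have e : (p : ℤ_[p]) ^ 2 * ∑ a ∈ Finset.range (p ^ (N + 1)), G a =
        p ^ 2 * (∑ x ∈ Finset.range (p ^ (N + 1)), G x -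
          p * ∑ a ∈ Finset.range (p ^ N), G a) +
        p * (p ^ 2 * ∑ a ∈ Finset.range (p ^ N), G a) := by ring
      rw [e]
      refine dvd_add ((pow_dvd_pow _ (by omega)).trans (h N)) ?_
      rw [pow_succ']
      exact mul_dvd_mul_left _ ih

/-- Sums of `c(a) y(a) ^ n` with `c` locally constant and `y` locally affine. -/
theorem pow_dvd_sum_mul_pow_succ_sub (hp : p ≠ 2) {c y w : ℕ → ℤ_[p]}
    (hc : ∀ N a j, c (a + p ^ (N + 1) * j) = c a)
    (hw : ∀ N a j, w (a + p ^ (N + 1) * j) = w a)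
    (hy : ∀ N a j, c a = 0 ∨ y (a + p ^ (N + 1) * j) = y a + p ^ N * j * w a)
    (n N : ℕ) :
    (p : ℤ_[p]) ^ (2 * N) ∣ p ^ 2 * (∑ x ∈ Finset.range (p ^ (N + 1)), c x * y x ^ n -
      p * ∑ a ∈ Finset.range (p ^ N), c a * y a ^ n) := by
  -- `H` is the formal derivative of `c y^n`. A shift of `a` by `p^(N+1) j` moves `y` only by a
  -- multiple of `p^N`, which is the loss that the factors `p` and `p^2` absorb.
  refine pow_dvd_sum_range_succ_sub hp (H := fun a => n * c a * w a * y a ^ (n - 1))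
    (fun N a j => ?_) (fun N a j => ?_) N
  · rcases N with _ | N
    · simp
    rw [hc, hw]
    rcases hy N a j with h0 | h
    · simp [h0]
    rw [h]
    obtain ⟨k, hk⟩ : (p : ℤ_[p]) ^ N * j * w a ∣
        (y a + p ^ N * j * w a) ^ (n - 1) - y a ^ (n - 1) := by
      simpa using sub_dvd_pow_sub_pow (y a + (p : ℤ_[p]) ^ N * j * w a) (y a) (n - 1)
    refine ⟨n * c a * w a * (j * w a * k), ?_⟩
    linear_combination (p * n * c a * w a) * hk
  · rcases N with _ | N
    · simp
    rw [hc]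
    rcases hy N a j with h0 | h
    · simp [h0]
    rw [h]
    obtain ⟨k, hk⟩ := Polynomial.powAddExpansion (y a) ((p : ℤ_[p]) ^ N * j * w a) n
    refine ⟨c a * k * (j * w a) ^ 2, ?_⟩
    rw [hk]
    ring

end Sums

/-! ### Teichmüller representatives and an integral form of `⟨x⟩`. -/

section Teichmuller

theorem dvd_iff_norm_le (x : ℤ_[p]) : (p : ℤ_[p]) ∣ x ↔ ‖x‖ ≤ (p : ℝ)⁻¹ := by
  have := PadicInt.norm_le_pow_iff_mem_span_pow x 1
  rw [pow_one, Ideal.mem_span_singleton] at this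
  rw [← this]
  simp [zpow_neg]

theorem dvd_teich_sub (x : ℤ_[p]) : (p : ℤ_[p]) ∣ teich p x - x := by
  rw [dvd_iff_norm_le]
  refine le_of_tendsto ((tendsto_teich x).sub_const x).norm (Eventually.of_forall fun n => ?_)
  rw [← dvd_iff_norm_le]
  induction n with
  | zero => simp
  | succ n ih =>
    rw [pow_succ, pow_mul]
    simpa using dvd_add (dvd_pow_sub_self (x ^ p ^ n)) ih

theorem teich_pow (x : ℤ_[p]) (n : ℕ) : teich p (x ^ n) = teich p x ^ n := by
  induction n with
  | zero => simp [teich_one]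
  | succ n ih => rw [pow_succ, teich_mul, ih, pow_succ]

theorem teich_pow_sub_one {x : ℤ_[p]} (h : ¬ (p : ℤ_[p]) ∣ x) : teich p x ^ (p - 1) = 1 := by
  have h0 : teich p x ≠ 0 := fun h0 => h (by simpa [h0] using dvd_teich_sub x)
  have h1 : teich p x ^ p = teich p x := by
    rw [← teich_pow]
    exact teich_congr (dvd_pow_sub_self x)
  refine mul_left_cancel₀ h0 ?_
  rw [← pow_succ', Nat.sub_add_cancel (Fact.out : p.Prime).one_le, h1, mul_one]

theorem teich_pow_congr {x : ℤ_[p]} (h : ¬ (p : ℤ_[p]) ∣ x) {k l : ℕ}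
    (hkl : (k : ZMod (p - 1)) = l) : teich p x ^ k = teich p x ^ l := by
  rw [ZMod.natCast_eq_natCast_iff] at hkl
  exact pow_eq_pow_of_modEq hkl (teich_pow_sub_one h)

theorem teich_natCast_add (N a j : ℕ) :
    teich p ((a + p ^ (N + 1) * j : ℕ) : ℤ_[p]) = teich p (a : ℤ_[p]) := by
  refine teich_congr ⟨p ^ N * j, ?_⟩
  push_cast
  ring

theorem natCast_dvd_iff (a : ℕ) : (p : ℤ_[p]) ∣ (a : ℤ_[p]) ↔ p ∣ a := by
  have := PadicInt.pow_p_dvd_int_iff (p := p) 1 a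
  simpa [Int.natCast_dvd_natCast] using this

variable (p) in
/-- The integral form of `⟨x⟩` for a unit `x`; it vanishes if `p ∣ x`. -/
noncomputable def unitAngle (x : ℤ_[p]) : ℤ_[p] := x * teich p x ^ (p - 2)

theorem teich_mul_unitAngle {x : ℤ_[p]} (h : ¬ (p : ℤ_[p]) ∣ x) :
    teich p x * unitAngle p x = x := by
  have h2 : p - 1 = p - 2 + 1 := by
    have := (Fact.out : p.Prime).two_le
    omega
  have := teich_pow_sub_one h
  rw [h2] at this
  rw [unitAngle]
  linear_combination x * this

theorem dvd_unitAngle_sub_one {x : ℤ_[p]} (h : ¬ (p : ℤ_[p]) ∣ x) :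
    (p : ℤ_[p]) ∣ unitAngle p x - 1 := by
  have hpr : Prime (p : ℤ_[p]) := PadicInt.prime_p
  have h1 : (p : ℤ_[p]) ∣ teich p x * (unitAngle p x - 1) := by
    rw [mul_sub, teich_mul_unitAngle h, mul_one, ← dvd_neg, neg_sub]
    exact dvd_teich_sub x
  refine (hpr.dvd_or_dvd h1).resolve_left fun h2 => h ?_
  simpa using dvd_sub h2 (dvd_teich_sub x)

end Teichmuller

/-! ### Norms under the embedding of `ℤ_p` in `ℂ_p`. -/

section ToCp

variable (p) in
theorem norm_toCp (x : ℤ_[p]) : ‖toCp p x‖ = ‖x‖ := by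
  rw [toCp, RingHom.comp_apply, norm_algebraMap']
  rfl

variable (p) in
theorem continuous_toCp : Continuous (toCp p) :=
  (AddMonoidHomClass.isometry_of_norm (toCp p) (norm_toCp p)).continuous

theorem toCp_eq_zero_iff {x : ℤ_[p]} : toCp p x = 0 ↔ x = 0 := by
  rw [← norm_eq_zero, norm_toCp, norm_eq_zero]

theorem norm_toCp_le_of_dvd {x : ℤ_[p]} {n : ℕ} (h : (p : ℤ_[p]) ^ n ∣ x) :
    ‖toCp p x‖ ≤ ((p : ℝ)⁻¹) ^ n := by
  obtain ⟨c, rfl⟩ := h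
  rw [norm_toCp, norm_mul, norm_pow, PadicInt.norm_p]
  exact mul_le_of_le_one_right (by positivity) (PadicInt.norm_le_one c)

variable (p) in
theorem norm_p : ‖(p : ℂ_[p])‖ = (p : ℝ)⁻¹ := by
  rw [← map_natCast (toCp p), norm_toCp, PadicInt.norm_p]

variable (p) in
theorem p_ne_zero : (p : ℂ_[p]) ≠ 0 :=
  Nat.cast_ne_zero.mpr (Fact.out : p.Prime).ne_zero

end ToCp

/-! ### Values of `ω^u` and `⟨·⟩` at integers prime to `p`. -/

section Values

theorem charEval_omegaPow_of_not_dvd (u : ZMod (p - 1)) {a : ℕ} (h : ¬ p ∣ a) :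
    charEval p (omegaPow p u) (a : ℤ_[p]) = toCp p (teich p (a : ℤ_[p]) ^ u.val) := by
  have hu : IsUnit (a : ZMod (p ^ 1)) := by
    rw [ZMod.isUnit_iff_coprime]
    exact Nat.Coprime.pow_right 1 ((Nat.Prime.coprime_iff_not_dvd Fact.out).mpr h).symm
  have h1 : omega p (a : ZMod (p ^ 1)) = toCp p (teich p (a : ℤ_[p])) := by
    change toCp p (teich p (((a : ZMod (p ^ 1)).val : ℕ) : ℤ_[p])) = _
    rw [teich_congr]
    exact dvd_natCast_sub ((ZMod.natCast_eq_natCast_iff _ _ _).mp (by rw [ZMod.natCast_zmod_val]))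
  obtain ⟨v, hv⟩ := hu
  rw [charEval, map_natCast, omegaPow, ← hv, MulChar.pow_apply_coe, hv, h1, map_pow]

theorem charEval_of_dvd (χ : DirichletCharacter ℂ_[p] (p ^ 1)) {a : ℕ} (h : p ∣ a) :
    charEval p χ (a : ℤ_[p]) = 0 := by
  rw [charEval, map_natCast]
  refine χ.map_nonunit fun hu => ?_
  rw [ZMod.isUnit_iff_coprime, pow_one] at hu
  exact (Nat.Prime.coprime_iff_not_dvd Fact.out).mp hu.symm h

theorem unitPart_of_not_dvd {x : ℤ_[p]} (h : ¬ (p : ℤ_[p]) ∣ x) : unitPart p x = x := by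
  have h0 : x ≠ 0 := fun h0 => h (by simp [h0])
  rw [unitPart, dif_neg h0]
  have h1 := PadicInt.unitCoeff_spec h0
  rcases Nat.eq_zero_or_pos x.valuation with hv | hv
  · rw [hv, pow_zero, mul_one] at h1
    exact h1.symm
  · exact absurd (h1 ▸ Dvd.dvd.mul_left (dvd_pow_self _ hv.ne') _) h

theorem angle_of_not_dvd {x : ℤ_[p]} (h : ¬ (p : ℤ_[p]) ∣ x) :
    angle p x = toCp p (unitAngle p x) := by
  have h0 : toCp p (teich p x) ≠ 0 := by
    rw [Ne, toCp_eq_zero_iff]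
    exact fun h0 => h (by simpa [h0] using dvd_teich_sub x)
  rw [angle, unitPart_of_not_dvd h, div_eq_iff h0, ← map_mul, mul_comm, teich_mul_unitAngle h]

end Values

/-! ### Estimates for binomial coefficients. -/

section Binomial

variable (p) in
/-- `√(1/p)`, the ratio of the geometric series that dominate the binomial series. -/
noncomputable def sqrtInv : ℝ := √((p : ℝ)⁻¹)

theorem sqrtInv_nonneg (p : ℕ) : 0 ≤ sqrtInv p := Real.sqrt_nonneg _

theorem sqrtInv_sq (p : ℕ) : sqrtInv p ^ 2 = (p : ℝ)⁻¹ := Real.sq_sqrt (by positivity)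

variable (p) in
theorem sqrtInv_lt_one : sqrtInv p < 1 := by
  rw [sqrtInv, Real.sqrt_lt' one_pos, one_pow]
  exact inv_p_lt_one

variable (p) in
theorem summable_sqrtInv_pow : Summable fun n : ℕ => sqrtInv p ^ n :=
  summable_geometric_of_lt_one (sqrtInv_nonneg p) (sqrtInv_lt_one p)

variable (p) in
theorem sqrtInv_pos : 0 < sqrtInv p :=
  Real.sqrt_pos.mpr (inv_pos.mpr (by exact_mod_cast (Fact.out : p.Prime).pos))

variable (p) in
theorem norm_natCast_of_ne_zero {m : ℕ} (hm : m ≠ 0) :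
    ‖(m : ℂ_[p])‖ = ((p : ℝ)⁻¹) ^ padicValNat p m := by
  have h : ((m : ℤ_[p]).valuation : ℤ) = padicValNat p m := by
    rw [← PadicInt.valuation_coe, PadicInt.coe_natCast, Padic.valuation_natCast]
  rw [← map_natCast (toCp p), norm_toCp, PadicInt.norm_eq_zpow_neg_valuation (by simpa using hm),
    h]
  simp

/-- Legendre's formula gives `v(n!) ≤ n/(p-1)`, which is at most `n/2` since `p ≥ 3`. -/
theorem norm_pow_div_factorial_le (hp : p ≠ 2) (n : ℕ) :
    ‖(p : ℂ_[p]) ^ n / (n.factorial : ℂ_[p])‖ ≤ sqrtInv p ^ n := by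
  have h1 := sub_one_mul_padicValNat_factorial (p := p) n
  have h2 := (Fact.out : p.Prime).two_le
  have h3 : 2 * padicValNat p n.factorial ≤ n := by
    have : 2 * padicValNat p n.factorial ≤ (p - 1) * padicValNat p n.factorial :=
      Nat.mul_le_mul_right _ (by omega)
    omega
  rw [norm_div, norm_pow, norm_p, norm_natCast_of_ne_zero p n.factorial_ne_zero, ← sqrtInv_sq,
    ← pow_mul, ← pow_mul, div_le_iff₀ (pow_pos (sqrtInv_pos p) _), ← pow_add]
  exact pow_le_pow_of_le_one (sqrtInv_nonneg p) (sqrtInv_lt_one p).le (by omega)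

/-- The polynomial `(s choose n + 1) / s` in `s`. -/
noncomputable def binomQuot (s : ℂ_[p]) (n : ℕ) : ℂ_[p] :=
  (∏ i ∈ Finset.range n, (s - (i + 1))) / ((n + 1).factorial : ℂ_[p])

theorem choose_succ_eq_mul_binomQuot (s : ℂ_[p]) (n : ℕ) :
    Ring.choose s (n + 1) = s * binomQuot s n := by
  have h := Ring.descPochhammer_eq_factorial_smul_choose s (n + 1)
  have h0 : ((n + 1).factorial : ℂ_[p]) ≠ 0 := Nat.cast_ne_zero.mpr (Nat.factorial_ne_zero _)
  have h2 : (descPochhammer ℤ (n + 1)).smeval s = ∏ i ∈ Finset.range (n + 1), (s - i) := by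
    rw [← descPochhammer_eval_eq_prod_range, ← Polynomial.aeval_eq_smeval, Polynomial.aeval_def,
      Polynomial.eval₂_eq_eval_map, descPochhammer_map]
  rw [h2, Finset.prod_range_succ', nsmul_eq_mul] at h
  rw [binomQuot, mul_div_assoc', eq_div_iff h0, mul_comm, ← h]
  push_cast
  ring

theorem norm_natCast_le_one (m : ℕ) : ‖(m : ℂ_[p])‖ ≤ 1 := by
  rw [← map_natCast (toCp p), norm_toCp]
  exact PadicInt.norm_le_one _

theorem norm_binomQuot_mul_le (hp : p ≠ 2) {s : ℂ_[p]} (hs : ‖s‖ ≤ 1) (n : ℕ) :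
    ‖binomQuot s n * p ^ (n + 1)‖ ≤ sqrtInv p ^ (n + 1) := by
  rw [binomQuot, div_mul_eq_mul_div, mul_div_assoc, norm_mul]
  refine (mul_le_of_le_one_left (norm_nonneg _) ?_).trans (norm_pow_div_factorial_le hp _)
  rw [norm_prod]
  refine Finset.prod_le_one (fun _ _ => norm_nonneg _) fun i _ => ?_
  rw [sub_eq_add_neg]
  refine (IsUltrametricDist.norm_add_le_max _ _).trans (max_le hs ?_)
  rw [norm_neg]
  exact_mod_cast norm_natCast_le_one (p := p) (i + 1)

theorem norm_choose_mul_le (hp : p ≠ 2) {s : ℂ_[p]} (hs : ‖s‖ ≤ 1) (n : ℕ) :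
    ‖Ring.choose s n * p ^ n‖ ≤ sqrtInv p ^ n := by
  rcases n with _ | n
  · simp
  · rw [choose_succ_eq_mul_binomQuot, mul_assoc, norm_mul]
    exact (mul_le_of_le_one_left (norm_nonneg _) hs).trans (norm_binomQuot_mul_le hp hs n)

theorem continuous_binomQuot (n : ℕ) : Continuous fun s : ℂ_[p] => binomQuot s n := by
  unfold binomQuot
  fun_prop

theorem continuous_choose (n : ℕ) : Continuous fun s : ℂ_[p] => Ring.choose s n := by
  rcases n with _ | n
  · simpa using continuous_const
  · simp only [choose_succ_eq_mul_binomQuot]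
    exact continuous_id.mul (continuous_binomQuot n)

end Binomial

/-! ### Volkenborn moments of `(⟨a⟩ - 1)/p`. -/

section Moments

/-- The value of `ω ^ u` at `a`, as a `p`-adic integer. -/
noncomputable def charInt (u : ZMod (p - 1)) (a : ℕ) : ℤ_[p] :=
  if p ∣ a then 0 else teich p (a : ℤ_[p]) ^ u.val

variable (p) in
/-- The quotient `(⟨a⟩ - 1) / p`, for `a` prime to `p`. -/
noncomputable def angleQuot (a : ℕ) : ℤ_[p] :=
  open Classical in
  if h : (p : ℤ_[p]) ∣ unitAngle p (a : ℤ_[p]) - 1 then h.choose else 0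

theorem unitAngle_sub_one {a : ℕ} (h : ¬ p ∣ a) :
    unitAngle p (a : ℤ_[p]) - 1 = p * angleQuot p a := by
  have h' := dvd_unitAngle_sub_one (mt (natCast_dvd_iff a).mp h)
  rw [angleQuot, dif_pos h']
  exact h'.choose_spec

theorem angle_sub_one {a : ℕ} (h : ¬ p ∣ a) :
    angle p (a : ℤ_[p]) - 1 = p * toCp p (angleQuot p a) := by
  rw [angle_of_not_dvd (mt (natCast_dvd_iff a).mp h), ← map_one (toCp p), ← map_sub,
    unitAngle_sub_one h, map_mul, map_natCast]

theorem charEval_omegaPow (u : ZMod (p - 1)) (a : ℕ) :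
    charEval p (omegaPow p u) (a : ℤ_[p]) = toCp p (charInt u a) := by
  rw [charInt]
  split_ifs with h
  · rw [charEval_of_dvd _ h, map_zero]
  · exact charEval_omegaPow_of_not_dvd u h

theorem dvd_add_pow_succ_mul_iff (p N a j : ℕ) : p ∣ a + p ^ (N + 1) * j ↔ p ∣ a :=
  (Nat.dvd_add_left ((dvd_pow_self p N.succ_ne_zero).mul_right j))

theorem charInt_add (u : ZMod (p - 1)) (N a j : ℕ) :
    charInt u (a + p ^ (N + 1) * j) = charInt u a := by
  simp only [charInt, dvd_add_pow_succ_mul_iff, teich_natCast_add]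

/-- On a residue class modulo `p` the Teichmüller factor is constant, so `⟨a⟩` is affine in `a`;
dividing by `p` costs one power. -/
theorem angleQuot_add {N a j : ℕ} (h : ¬ p ∣ a) :
    angleQuot p (a + p ^ (N + 1) * j) =
      angleQuot p a + p ^ N * j * teich p (a : ℤ_[p]) ^ (p - 2) := by
  have hp0 : (p : ℤ_[p]) ≠ 0 := Nat.cast_ne_zero.mpr (Fact.out : p.Prime).ne_zero
  have h1 := unitAngle_sub_one (mt (dvd_add_pow_succ_mul_iff p N a j).mp h)
  have h2 := unitAngle_sub_one h
  rw [unitAngle, teich_natCast_add] at h1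
  rw [unitAngle] at h2
  refine mul_left_cancel₀ hp0 ?_
  push_cast at h1
  linear_combination h2 - h1

/-- The Riemann sums of the Volkenborn integral of `ω ^ u (a) ((⟨a⟩ - 1) / p) ^ n`. -/
noncomputable def moment (u : ZMod (p - 1)) (n N : ℕ) : ℂ_[p] :=
  ((p : ℂ_[p]) ^ N)⁻¹ *
    toCp p (∑ a ∈ Finset.range (p ^ N), charInt u a * angleQuot p a ^ n)

/-- The Volkenborn integral of `ω ^ u (a) ((⟨a⟩ - 1) / p) ^ n`. -/
noncomputable def momentLim (u : ZMod (p - 1)) (n : ℕ) : ℂ_[p] := limUnder atTop (moment u n)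

theorem pow_dvd_moment_sum_succ_sub (hp : p ≠ 2) (u : ZMod (p - 1)) (n N : ℕ) :
    (p : ℤ_[p]) ^ (2 * N) ∣ p ^ 2 *
      (∑ a ∈ Finset.range (p ^ (N + 1)), charInt u a * angleQuot p a ^ n -
        p * ∑ a ∈ Finset.range (p ^ N), charInt u a * angleQuot p a ^ n) := by
  refine pow_dvd_sum_mul_pow_succ_sub hp (w := fun a => teich p (a : ℤ_[p]) ^ (p - 2))
    (charInt_add u) (fun N a j => by rw [teich_natCast_add]) (fun N a j => ?_) n N
  by_cases h : p ∣ a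
  · exact Or.inl (if_pos h)
  · exact Or.inr (angleQuot_add h)

theorem norm_inv_pow_mul_toCp_le {x : ℤ_[p]} {M N : ℕ} (h : (p : ℤ_[p]) ^ M ∣ p ^ 2 * x) :
    ‖((p : ℂ_[p]) ^ N)⁻¹ * toCp p x‖ * ((p : ℝ)⁻¹) ^ (N + 2) ≤ ((p : ℝ)⁻¹) ^ M := by
  have hp0 : (p : ℝ) ≠ 0 := Nat.cast_ne_zero.mpr (Fact.out : p.Prime).ne_zero
  refine le_trans (le_of_eq ?_) (norm_toCp_le_of_dvd h)
  rw [map_mul, norm_mul, norm_mul, norm_inv, norm_pow, norm_p, map_pow, map_natCast, norm_pow,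
    norm_p, inv_pow, inv_inv, pow_add, inv_pow]
  field_simp

/-- Uniformity in both `n` and `N` is what later allows dominated convergence. -/
theorem norm_moment_le (hp : p ≠ 2) (u : ZMod (p - 1)) (n N : ℕ) :
    ‖moment u n N‖ ≤ (p : ℝ) ^ 2 := by
  have hp0 : (0 : ℝ) < p := Nat.cast_pos.mpr (Fact.out : p.Prime).pos
  have h := norm_inv_pow_mul_toCp_le (N := N)
    (pow_dvd_sum_range_of_succ_sub (pow_dvd_moment_sum_succ_sub hp u n) N)
  rw [pow_add, ← mul_assoc, mul_right_comm] at h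
  have h2 := le_of_mul_le_mul_right (h.trans_eq (one_mul _).symm) (by positivity)
  rw [moment]
  rwa [inv_pow, ← div_eq_mul_inv, div_le_one (by positivity)] at h2

theorem norm_moment_succ_sub_le (hp : p ≠ 2) (u : ZMod (p - 1)) (n N : ℕ) :
    ‖moment u n (N + 1) - moment u n N‖ ≤ (p : ℝ) ^ 3 * ((p : ℝ)⁻¹) ^ N := by
  have hp0 : (0 : ℝ) < p := Nat.cast_pos.mpr (Fact.out : p.Prime).pos
  have h := norm_inv_pow_mul_toCp_le (N := N + 1) (pow_dvd_moment_sum_succ_sub hp u n N)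
  have e : moment u n (N + 1) - moment u n N = ((p : ℂ_[p]) ^ (N + 1))⁻¹ * toCp p
      (∑ a ∈ Finset.range (p ^ (N + 1)), charInt u a * angleQuot p a ^ n -
        p * ∑ a ∈ Finset.range (p ^ N), charInt u a * angleQuot p a ^ n) := by
    have := p_ne_zero p
    rw [map_sub, map_mul, map_natCast, moment, moment]
    field_simp
    ring
  rw [e]
  -- Division by `p^(N+1)` and the lost `p^2` turn `p^(-2N)` into `p^(3-N)`.
  have e2 : ((p : ℝ)⁻¹) ^ (2 * N) = (p : ℝ) ^ 3 * ((p : ℝ)⁻¹) ^ N * ((p : ℝ)⁻¹) ^ (N + 1 + 2) := by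
    simp only [inv_pow]
    field_simp
    ring
  exact le_of_mul_le_mul_right (h.trans_eq e2) (by positivity)

theorem tendsto_moment (hp : p ≠ 2) (u : ZMod (p - 1)) (n : ℕ) :
    Tendsto (moment u n) atTop (𝓝 (momentLim u n)) := by
  refine CauchySeq.tendsto_limUnder
    (cauchySeq_of_le_geometric (p : ℝ)⁻¹ ((p : ℝ) ^ 3) inv_p_lt_one fun N => ?_)
  rw [dist_comm, dist_eq_norm]
  exact norm_moment_succ_sub_le hp u n N

theorem norm_momentLim_le (hp : p ≠ 2) (u : ZMod (p - 1)) (n : ℕ) :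
    ‖momentLim u n‖ ≤ (p : ℝ) ^ 2 :=
  le_of_tendsto (tendsto_moment hp u n).norm (Eventually.of_forall (norm_moment_le hp u n))

end Moments

/-! ### The Volkenborn integral as a series in `s`. -/

section Volkenborn

theorem norm_choose_mul_angle_pow_le (hp : p ≠ 2) {s : ℂ_[p]} (hs : ‖s‖ ≤ 1) {a : ℕ}
    (ha : ¬ p ∣ a) (n : ℕ) :
    ‖Ring.choose s n * (angle p (a : ℤ_[p]) - 1) ^ n‖ ≤ sqrtInv p ^ n := by
  rw [angle_sub_one ha, mul_pow, ← mul_assoc, norm_mul, ← map_pow, norm_toCp]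
  exact (mul_le_of_le_one_right (norm_nonneg _) (PadicInt.norm_le_one _)).trans
    (norm_choose_mul_le hp hs n)

theorem summable_choose_mul_angle_pow (hp : p ≠ 2) {s : ℂ_[p]} (hs : ‖s‖ ≤ 1) {a : ℕ}
    (ha : ¬ p ∣ a) : Summable fun n => Ring.choose s n * (angle p (a : ℤ_[p]) - 1) ^ n :=
  (summable_sqrtInv_pow p).of_norm_bounded (norm_choose_mul_angle_pow_le hp hs ha)

theorem hasSum_charEval_mul_anglePow (hp : p ≠ 2) (u : ZMod (p - 1)) {s : ℂ_[p]} (hs : ‖s‖ ≤ 1)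
    (a : ℕ) :
    HasSum (fun n => Ring.choose s n * p ^ n * toCp p (charInt u a * angleQuot p a ^ n))
      (charEval p (omegaPow p u) (a : ℤ_[p]) * anglePow p (a : ℤ_[p]) s) := by
  rw [charEval_omegaPow]
  by_cases h : p ∣ a
  -- The character kills both sides, so convergence of the series for `⟨a⟩^s` is not needed here.
  · simp [charInt, h]
  · refine ((summable_choose_mul_angle_pow hp hs h).hasSum.mul_left
      (toCp p (charInt u a))).congr_fun fun n => ?_
    rw [angle_sub_one h, map_mul, map_pow]
    ring

/-- The value of the Volkenborn integral of `ω ^ u (a) ⟨a⟩ ^ s`. -/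
noncomputable def volkenbornSeries (u : ZMod (p - 1)) (s : ℂ_[p]) : ℂ_[p] :=
  ∑' n, Ring.choose s n * p ^ n * momentLim u n

/-- The quotient of the nonconstant part of `volkenbornSeries u s` by `s`. -/
noncomputable def volkenbornQuot (u : ZMod (p - 1)) (s : ℂ_[p]) : ℂ_[p] :=
  ∑' n, binomQuot s n * p ^ (n + 1) * momentLim u (n + 1)

theorem tendsto_volkenborn_sum (hp : p ≠ 2) (u : ZMod (p - 1)) {s : ℂ_[p]} (hs : ‖s‖ ≤ 1) :
    Tendsto (fun N : ℕ => ((p : ℂ_[p]) ^ N)⁻¹ * ∑ a ∈ Finset.range (p ^ N),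
        charEval p (omegaPow p u) (a : ℤ_[p]) * anglePow p (a : ℤ_[p]) s)
      atTop (𝓝 (volkenbornSeries u s)) := by
  have h : Tendsto (fun N : ℕ => ∑' n, Ring.choose s n * p ^ n * moment u n N) atTop
      (𝓝 (volkenbornSeries u s)) := by
    refine tendsto_tsum_of_dominated_convergence ((summable_sqrtInv_pow p).mul_right ((p : ℝ) ^ 2))
      (fun n => (tendsto_moment hp u n).const_mul _) (Eventually.of_forall fun N n => ?_)
    rw [norm_mul]
    exact mul_le_mul (norm_choose_mul_le hp hs n) (norm_moment_le hp u n N) (norm_nonneg _)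
      (pow_nonneg (sqrtInv_nonneg p) _)
  refine h.congr fun N => HasSum.tsum_eq ?_
  refine ((hasSum_sum fun a _ => hasSum_charEval_mul_anglePow hp u hs a).mul_left
    (((p : ℂ_[p]) ^ N)⁻¹)).congr_fun fun n => ?_
  rw [moment, map_sum, ← Finset.mul_sum]
  ring

theorem volkenborn_eq (hp : p ≠ 2) (u : ZMod (p - 1)) {s : ℂ_[p]} (hs : ‖s‖ ≤ 1) :
    (volkenborn p fun a => charEval p (omegaPow p u) (0 + a) * anglePow p (0 + a) s) =
      volkenbornSeries u s := by
  simp only [zero_add]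
  exact (tendsto_volkenborn_sum hp u hs).limUnder_eq

theorem norm_volkenbornQuot_term_le (hp : p ≠ 2) (u : ZMod (p - 1)) {s : ℂ_[p]} (hs : ‖s‖ ≤ 1)
    (n : ℕ) : ‖binomQuot s n * p ^ (n + 1) * momentLim u (n + 1)‖ ≤
      sqrtInv p ^ (n + 1) * (p : ℝ) ^ 2 := by
  rw [norm_mul]
  exact mul_le_mul (norm_binomQuot_mul_le hp hs n) (norm_momentLim_le hp u _) (norm_nonneg _)
      (pow_nonneg (sqrtInv_nonneg p) _)

theorem summable_sqrtInv_pow_succ_mul :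
    Summable fun n : ℕ => sqrtInv p ^ (n + 1) * (p : ℝ) ^ 2 :=
  ((summable_nat_add_iff 1).mpr (summable_sqrtInv_pow p)).mul_right _

theorem continuousOn_volkenbornQuot (hp : p ≠ 2) (u : ZMod (p - 1)) :
    ContinuousOn (volkenbornQuot u) {s : ℂ_[p] | ‖s‖ ≤ 1} :=
  continuousOn_tsum (fun n => (((continuous_binomQuot n).mul_const _).mul_const _).continuousOn)
    summable_sqrtInv_pow_succ_mul fun n _ hs => norm_volkenbornQuot_term_le hp u hs n

/-- Every binomial coefficient after the first is divisible by `s`; this isolates the residue of the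
zeta function. -/
theorem volkenbornSeries_eq (hp : p ≠ 2) (u : ZMod (p - 1)) {s : ℂ_[p]} (hs : ‖s‖ ≤ 1) :
    volkenbornSeries u s = momentLim u 0 + s * volkenbornQuot u s := by
  have h1 : Summable fun n => binomQuot s n * p ^ (n + 1) * momentLim u (n + 1) :=
    summable_sqrtInv_pow_succ_mul.of_norm_bounded (norm_volkenbornQuot_term_le hp u hs)
  have h2 : ∀ n, Ring.choose s (n + 1) * p ^ (n + 1) * momentLim u (n + 1) =
      s * (binomQuot s n * p ^ (n + 1) * momentLim u (n + 1)) := fun n => by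
    rw [choose_succ_eq_mul_binomQuot]
    ring
  rw [volkenbornSeries, Summable.tsum_eq_zero_add, volkenbornQuot, ← h1.tsum_mul_left]
  · simp only [h2]
    simp
  · rw [← summable_nat_add_iff 1]
    simpa only [h2] using h1.mul_left s

end Volkenborn

/-! ### Bernoulli numbers and interpolation at positive integers. -/

section Bernoulli

variable (p) in
/-- The Volkenborn integral of `a ^ k` is the Bernoulli number `B_k`. -/
theorem tendsto_sum_range_pow_bernoulli (k : ℕ) :
    Tendsto (fun N : ℕ => ((p : ℂ_[p]) ^ N)⁻¹ * ∑ a ∈ Finset.range (p ^ N), (a : ℂ_[p]) ^ k)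
      atTop (𝓝 ((bernoulli k : ℚ) : ℂ_[p])) := by
  have hp0 := p_ne_zero p
  have hk : ((k : ℂ_[p]) + 1) ≠ 0 := Nat.cast_add_one_ne_zero k
  have h1 : Tendsto (fun N : ℕ => (p : ℂ_[p]) ^ N) atTop (𝓝 0) :=
    tendsto_pow_atTop_nhds_zero_of_norm_lt_one (by rw [norm_p]; exact inv_p_lt_one)
  -- This is Faulhaber's formula divided by `p^N`: only the term `i = k` has no factor `p^N` left.
  have h2 : Tendsto (fun N : ℕ => ∑ i ∈ Finset.range (k + 1), ((bernoulli i : ℚ) : ℂ_[p]) *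
      ((k + 1).choose i : ℂ_[p]) / ((k : ℂ_[p]) + 1) * ((p : ℂ_[p]) ^ N) ^ (k - i)) atTop
      (𝓝 (∑ i ∈ Finset.range (k + 1), if i = k then ((bernoulli k : ℚ) : ℂ_[p]) else 0)) := by
    refine tendsto_finsetSum _ fun i hi => ?_
    split_ifs with h
    · subst h
      simp only [Nat.sub_self, pow_zero, mul_one, Nat.choose_succ_self_right, Nat.cast_add,
        Nat.cast_one, mul_div_cancel_right₀ _ hk]
      exact tendsto_const_nhds
    · have hik : k - i ≠ 0 := by
        have := Finset.mem_range.mp hi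
        omega
      simpa [hik] using (h1.pow (k - i)).const_mul (((bernoulli i : ℚ) : ℂ_[p]) *
        ((k + 1).choose i : ℂ_[p]) / ((k : ℂ_[p]) + 1))
  rw [Finset.sum_ite_eq' (Finset.range (k + 1)) k, if_pos (by simp)] at h2
  refine h2.congr fun N => ?_
  have h3 := congrArg (Rat.cast : ℚ → ℂ_[p]) (sum_range_pow (p ^ N) k)
  push_cast at h3
  rw [h3, Finset.mul_sum]
  refine Finset.sum_congr rfl fun i hi => ?_
  have e : k + 1 - i = k - i + 1 := by
    have := Finset.mem_range.mp hi
    omega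
  rw [e]
  field_simp
  ring

theorem sum_range_pow_succ_filter (k M : ℕ) :
    ∑ a ∈ Finset.range (p ^ (M + 1)), (if p ∣ a then 0 else (a : ℂ_[p]) ^ k) =
      ∑ a ∈ Finset.range (p ^ (M + 1)), (a : ℂ_[p]) ^ k -
        p ^ k * ∑ b ∈ Finset.range (p ^ M), (b : ℂ_[p]) ^ k := by
  have hp := (Fact.out : p.Prime).pos
  have h1 : ∑ a ∈ Finset.range (p ^ (M + 1)), (if p ∣ a then (a : ℂ_[p]) ^ k else 0) =
      p ^ k * ∑ b ∈ Finset.range (p ^ M), (b : ℂ_[p]) ^ k := by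
    rw [pow_succ', sum_range_mul_eq, Finset.mul_sum]
    refine Finset.sum_congr rfl fun j _ => ?_
    rw [Finset.sum_eq_single_of_mem 0 (Finset.mem_range.mpr hp)]
    · simp [mul_pow]
    · intro a ha ha0
      refine if_neg fun h => ?_
      rw [Nat.dvd_add_left (dvd_mul_right p j)] at h
      exact absurd (Nat.le_of_dvd (Nat.pos_of_ne_zero ha0) h) (by simpa using ha)
  rw [← h1, ← Finset.sum_sub_distrib]
  refine Finset.sum_congr rfl fun a _ => ?_
  split_ifs <;> simp

theorem anglePow_natCast (x : ℤ_[p]) (k : ℕ) : anglePow p x (k : ℂ_[p]) = angle p x ^ k := by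
  rw [anglePow, tsum_eq_sum (s := Finset.range (k + 1))]
  · conv_rhs => rw [← sub_add_cancel (angle p x) 1, add_pow]
    refine Finset.sum_congr rfl fun n _ => ?_
    rw [Ring.choose_natCast, one_pow, mul_one, mul_comm]
  · intro n hn
    rw [Ring.choose_natCast, Nat.choose_eq_zero_of_lt (by simpa using hn)]
    simp

theorem charEval_mul_anglePow_natCast {u : ZMod (p - 1)} {k : ℕ} (hk : (k : ZMod (p - 1)) = u)
    (a : ℕ) :
    charEval p (omegaPow p u) (a : ℤ_[p]) * anglePow p (a : ℤ_[p]) (k : ℂ_[p]) =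
      if p ∣ a then 0 else (a : ℂ_[p]) ^ k := by
  have : NeZero (p - 1) := ⟨by have := (Fact.out : p.Prime).two_le; omega⟩
  split_ifs with h
  · rw [charEval_of_dvd _ h, zero_mul]
  · have h' := mt (natCast_dvd_iff a).mp h
    have hu : (u.val : ZMod (p - 1)) = (k : ZMod (p - 1)) := by rw [ZMod.natCast_zmod_val, hk]
    rw [charEval_omegaPow_of_not_dvd u h, teich_pow_congr h' hu, anglePow_natCast,
      angle_of_not_dvd h', ← map_pow, ← map_mul, ← mul_pow, teich_mul_unitAngle h', map_pow,
      map_natCast]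

/-- The integrand is `a^k` off `pℤ_p`. The omitted multiples `p b` contribute `p^k ∑ b^k / p^(M+1)`
with `b < p^M`, whose limit is `p^(k-1) B_k`. -/
theorem volkenbornSeries_natCast (hp : p ≠ 2) {u : ZMod (p - 1)} {k : ℕ} (hk0 : k ≠ 0)
    (hk : (k : ZMod (p - 1)) = u) :
    volkenbornSeries u (k : ℂ_[p]) = (1 - (p : ℂ_[p]) ^ (k - 1)) * ((bernoulli k : ℚ) : ℂ_[p]) := by
  have hp0 := p_ne_zero p
  have h1 := (tendsto_add_atTop_iff_nat 1).mpr
    (tendsto_volkenborn_sum hp u (norm_natCast_le_one (p := p) k))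
  have h2 := (((tendsto_add_atTop_iff_nat 1).mpr (tendsto_sum_range_pow_bernoulli p k)).sub
    ((tendsto_sum_range_pow_bernoulli p k).const_mul ((p : ℂ_[p]) ^ (k - 1))))
  rw [sub_mul, one_mul]
  refine tendsto_nhds_unique h1 (h2.congr fun M => ?_)
  simp only [charEval_mul_anglePow_natCast hk]
  rw [sum_range_pow_succ_filter k M]
  obtain ⟨m, rfl⟩ := Nat.exists_eq_succ_of_ne_zero hk0
  rw [Nat.succ_sub_one, Nat.succ_eq_add_one, pow_succ (p : ℂ_[p]) m]
  field_simp
  ring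

end Bernoulli

/-! ### Vanishing of the zeroth moment for `u ≠ 0`. -/

section Orthogonality

/-- Reducing modulo `p` turns `ω^u = 1` into `x^u = 1` on all of `𝔽_p^×`, so `p - 1` divides `u.val
< p - 1`. -/
theorem omegaPow_ne_one {u : ZMod (p - 1)} (hu : u ≠ 0) : omegaPow p u ≠ 1 := by
  have : NeZero (p - 1) := ⟨by have := (Fact.out : p.Prime).two_le; omega⟩
  intro h
  have key : ∀ x : (ZMod p)ˣ, x ^ u.val = 1 := by
    intro x
    have hx : ¬ p ∣ (x : ZMod p).val := fun hd => by
      have := (ZMod.natCast_eq_zero_iff _ p).mpr hd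
      rw [ZMod.natCast_zmod_val] at this
      exact x.ne_zero this
    have h1 := charEval_omegaPow_of_not_dvd u hx
    have hunit : IsUnit (((x : ZMod p).val : ℕ) : ZMod (p ^ 1)) := by
      rw [ZMod.isUnit_iff_coprime]
      exact Nat.Coprime.pow_right 1 ((Nat.Prime.coprime_iff_not_dvd Fact.out).mpr hx).symm
    rw [h, charEval, map_natCast, MulChar.one_apply hunit, ← map_one (toCp p)] at h1
    have h2 := (((injective_iff_map_eq_zero (toCp p)).mpr fun _ => toCp_eq_zero_iff.mp) h1).symm
    have h3 : PadicInt.toZMod (teich p (((x : ZMod p).val : ℕ) : ℤ_[p])) = (x : ZMod p) := by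
      have := dvd_teich_sub (((x : ZMod p).val : ℕ) : ℤ_[p])
      rw [← Ideal.mem_span_singleton, ← PadicInt.maximalIdeal_eq_span_p, ← PadicInt.ker_toZMod,
        RingHom.mem_ker, map_sub, map_natCast, ZMod.natCast_zmod_val, sub_eq_zero] at this
      exact this
    have h4 := congrArg PadicInt.toZMod h2
    rw [map_pow, h3, map_one] at h4
    exact Units.ext (by simpa using h4)
  have hdvd := (FiniteField.forall_pow_eq_one_iff (ZMod p) u.val).mp key
  rw [ZMod.card] at hdvd
  exact hu ((ZMod.val_eq_zero u).mp (Nat.eq_zero_of_dvd_of_lt hdvd (ZMod.val_lt u)))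

theorem sum_range_charInt {u : ZMod (p - 1)} (hu : u ≠ 0) :
    ∑ a ∈ Finset.range p, charInt u a = 0 := by
  have : NeZero (p ^ 1) := ⟨pow_ne_zero 1 (Fact.out : p.Prime).ne_zero⟩
  rw [← toCp_eq_zero_iff, map_sum, ← MulChar.sum_eq_zero_of_ne_one (omegaPow_ne_one hu)]
  refine Finset.sum_nbij' (fun a => (a : ZMod (p ^ 1))) ZMod.val (fun _ _ => Finset.mem_univ _)
    (fun a _ => ?_) (fun a ha => ?_) (fun a _ => ZMod.natCast_zmod_val a) (fun a _ => ?_)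
  · simpa using ZMod.val_lt a
  · exact ZMod.val_cast_of_lt (by simpa using ha)
  · rw [← charEval_omegaPow, charEval, map_natCast]

/-- From `N = 1` on, the Riemann sums run over full periods of a nontrivial character and vanish
exactly. -/
theorem momentLim_zero (hp : p ≠ 2) {u : ZMod (p - 1)} (hu : u ≠ 0) : momentLim u 0 = 0 := by
  refine tendsto_nhds_unique ((tendsto_add_atTop_iff_nat 1).mpr (tendsto_moment hp u 0)) ?_
  refine tendsto_const_nhds.congr fun N => ?_
  have h (a j : ℕ) : charInt u (a + p * j) = charInt u a := by
    simpa using charInt_add u 0 a j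
  rw [moment]
  simp only [pow_zero, mul_one]
  rw [pow_succ', pow_succ', sum_range_mul_eq]
  simp [h, sum_range_charInt hu]

end Orthogonality

/-! ### The zeta value, including the removable singularity. -/

section Zeta

theorem hurwitzZetaAux_one_sub (hp : p ≠ 2) (u : ZMod (p - 1)) {s : ℂ_[p]} (hs : ‖s‖ ≤ 1) :
    hurwitzZetaAux p (1 - s) (omegaPow p u) 0 = -(volkenbornSeries u s / s) := by
  rw [hurwitzZetaAux, sub_sub_cancel, volkenborn_eq hp u hs, sub_sub_cancel_left]
  ring

theorem hurwitzZeta_one_sub (hp : p ≠ 2) {u : ZMod (p - 1)} {s : ℂ_[p]} (hs : ‖s‖ ≤ 1)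
    (h : s ≠ 0 ∨ u ≠ 0) :
    hurwitzZeta p (1 - s) (omegaPow p u) 0 = -(momentLim u 0 / s + volkenbornQuot u s) := by
  by_cases h0 : s = 0
  · have hu := h.resolve_left (not_not.mpr h0)
    subst h0
    -- At `s = 0` the pole term reads `0 / 0 = 0`, leaving the limit of `-Q(1 - t)` as `t → 1`.
    rw [hurwitzZeta, if_pos (sub_zero 1), momentLim_zero hp hu, zero_div, zero_add]
    refine Tendsto.limUnder_eq ?_
    have hball : {s : ℂ_[p] | ‖s‖ ≤ 1} ∈ 𝓝 (0 : ℂ_[p]) := by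
      filter_upwards [Metric.ball_mem_nhds (0 : ℂ_[p]) one_pos] with s hs
      exact (mem_ball_zero_iff.mp hs).le
    have hsub : Tendsto (fun t : ℂ_[p] => 1 - t) (𝓝[≠] 1) (𝓝 0) := by
      have : Continuous fun t : ℂ_[p] => 1 - t := by fun_prop
      simpa using (this.tendsto 1).mono_left nhdsWithin_le_nhds
    refine ((((continuousOn_volkenbornQuot hp u).continuousAt hball).tendsto.comp hsub).neg).congr'
      ?_
    filter_upwards [hsub hball, self_mem_nhdsWithin] with t ht ht1
    have ht0 : 1 - t ≠ 0 := sub_ne_zero.mpr (Ne.symm ht1)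
    have := hurwitzZetaAux_one_sub hp u ht
    rw [sub_sub_cancel] at this
    rw [this, volkenbornSeries_eq hp u ht, momentLim_zero hp hu, zero_add,
      mul_div_cancel_left₀ _ ht0]
    rfl
  · rw [hurwitzZeta, if_neg (by simpa using h0), hurwitzZetaAux_one_sub hp u hs,
      volkenbornSeries_eq hp u hs, add_div, mul_div_cancel_left₀ _ h0]

end Zeta

/-! ### Integrals against `μ_n`. -/

section Measure

/-- Once `N ≥ n`, each divisor is below `p^N` and is the chosen representative of its own coset, so
the Riemann sums are constant. -/
theorem measureIntegral_mu (n : ℕ) (f : ℤ_[p] → ℂ_[p]) :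
    measureIntegral p (mu p n) f =
      ∑ d ∈ n.divisors with Nat.Coprime p d, (d : ℂ_[p])⁻¹ * f (d : ℤ_[p]) := by
  refine (tendsto_const_nhds.congr' ?_).limUnder_eq
  filter_upwards [eventually_ge_atTop n] with N hN
  simp only [mu, Finset.mul_sum]
  rw [Finset.sum_comm]
  refine Finset.sum_congr rfl fun d hd => ?_
  have hdn : d < p ^ N := by
    have h1 : d ∈ n.divisors := (Finset.mem_filter.mp hd).1
    exact ((Nat.divisor_le h1).trans hN).trans_lt (Nat.lt_pow_self (Fact.out : p.Prime).one_lt)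
  have hmem (a : ℕ) (ha : a < p ^ N) : (d : ℤ_[p]) ∈ coset p (a : ℤ_[p]) N ↔ a = d := by
    have h := PadicInt.pow_p_dvd_int_iff (p := p) N ((d : ℤ) - a)
    push_cast at h
    rw [coset, Set.mem_ofPred_eq, h]
    refine ⟨fun h2 => ?_, fun h2 => by simp [h2]⟩
    have h3 : a ≡ d [MOD p ^ N] := Nat.modEq_iff_dvd.mpr (by exact_mod_cast h2)
    exact Nat.ModEq.eq_of_lt_of_lt h3 ha hdn
  rw [Finset.sum_eq_single_of_mem d (Finset.mem_range.mpr hdn)]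
  · rw [delta, if_pos ((hmem d hdn).mpr rfl)]
    ring
  · intro a ha had
    rw [delta, if_neg (mt (hmem a (Finset.mem_range.mp ha)).mp had)]
    ring

theorem familyCoeff_of_ne_zero {v : ℕ} (s : ℂ_[p]) (χ : DirichletCharacter ℂ_[p] (p ^ v)) {n : ℕ}
    (hn : n ≠ 0) :
    familyCoeff p s χ 0 n = ∑ d ∈ n.divisors with Nat.Coprime p d,
      (d : ℂ_[p])⁻¹ * (charEval p χ (d : ℤ_[p]) * anglePow p (d : ℤ_[p]) s) := by
  rw [familyCoeff, if_neg hn, measureIntegral_mu]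
  simp only [zero_add]

end Measure

/-! ### Uniform continuity in the weight. -/

section Limits

/-- This sum bounds the variation of `⟨a⟩^s` in `s` for all `a` prime to `p` at once. -/
theorem tendsto_tsum_norm_choose_sub (hp : p ≠ 2) {ι : Type*} {l : Filter ι} {t : ι → ℂ_[p]}
    {s : ℂ_[p]} (ht : ∀ i, ‖t i‖ ≤ 1) (hs : ‖s‖ ≤ 1) (h : Tendsto t l (𝓝 s)) :
    Tendsto (fun i => ∑' n, ‖Ring.choose (t i) n * (p : ℂ_[p]) ^ n - Ring.choose s n * p ^ n‖) l
      (𝓝 0) := by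
  rw [← tsum_zero (α := ℝ) (β := ℕ)]
  refine tendsto_tsum_of_dominated_convergence ((summable_sqrtInv_pow p).mul_left 2)
    (fun n => ?_) (Eventually.of_forall fun i n => ?_)
  · have h1 := ((continuous_choose (p := p) n).tendsto s).comp h
    simpa using ((h1.mul_const ((p : ℂ_[p]) ^ n)).sub_const (Ring.choose s n * p ^ n)).norm
  · rw [norm_norm, two_mul]
    exact (norm_sub_le _ _).trans
      (add_le_add (norm_choose_mul_le hp (ht i) n) (norm_choose_mul_le hp hs n))

theorem summable_norm_choose_sub (hp : p ≠ 2) {s t : ℂ_[p]} (ht : ‖t‖ ≤ 1) (hs : ‖s‖ ≤ 1) :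
    Summable fun n => ‖Ring.choose t n * (p : ℂ_[p]) ^ n - Ring.choose s n * p ^ n‖ := by
  refine ((summable_sqrtInv_pow p).mul_left 2).of_nonneg_of_le (fun _ => norm_nonneg _) fun n => ?_
  rw [two_mul]
  exact (norm_sub_le _ _).trans
    (add_le_add (norm_choose_mul_le hp ht n) (norm_choose_mul_le hp hs n))

theorem norm_anglePow_sub_le (hp : p ≠ 2) {s t : ℂ_[p]} (ht : ‖t‖ ≤ 1) (hs : ‖s‖ ≤ 1) {a : ℕ}
    (ha : ¬ p ∣ a) :
    ‖anglePow p (a : ℤ_[p]) t - anglePow p (a : ℤ_[p]) s‖ ≤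
      ∑' n, ‖Ring.choose t n * (p : ℂ_[p]) ^ n - Ring.choose s n * p ^ n‖ := by
  rw [anglePow, anglePow, ← (summable_choose_mul_angle_pow hp ht ha).tsum_sub
    (summable_choose_mul_angle_pow hp hs ha)]
  refine tsum_of_norm_bounded (summable_norm_choose_sub hp ht hs).hasSum fun n => ?_
  rw [angle_sub_one ha, mul_pow, ← mul_assoc, ← mul_assoc, ← sub_mul, norm_mul, ← map_pow,
    norm_toCp]
  exact mul_le_of_le_one_right (norm_nonneg _) (PadicInt.norm_le_one _)

/-- The ultrametric inequality makes the bound independent of the number of divisors, hence of the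
coefficient index. -/
theorem norm_sigma_sub_familyCoeff_le (hp : p ≠ 2) {u : ZMod (p - 1)} {s : ℂ_[p]} (hs : ‖s‖ ≤ 1)
    {k : ℕ} (hk0 : k ≠ 0) (hk : (k : ZMod (p - 1)) = u) {n : ℕ} (hn : n ≠ 0) :
    ‖((ArithmeticFunction.sigma (k - 1) n : ℕ) : ℂ_[p]) - familyCoeff p s (omegaPow p u) 0 n‖ ≤
      max (((p : ℝ)⁻¹) ^ (k - 1))
        (∑' n, ‖Ring.choose (k : ℂ_[p]) n * (p : ℂ_[p]) ^ n - Ring.choose s n * p ^ n‖) := by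
  rw [familyCoeff_of_ne_zero _ _ hn, Finset.sum_filter, ArithmeticFunction.sigma_apply,
    Nat.cast_sum, ← Finset.sum_sub_distrib]
  refine IsUltrametricDist.norm_sum_le_of_forall_le_of_nonneg (le_max_of_le_left (by positivity))
    fun d hd => ?_
  have hd0 : d ≠ 0 := (Nat.pos_of_mem_divisors hd).ne'
  have hdp : (d : ℂ_[p]) ≠ 0 := Nat.cast_ne_zero.mpr hd0
  split_ifs with hc
  · refine le_max_of_le_right ?_
    have hpd := (Nat.Prime.coprime_iff_not_dvd Fact.out).mp hc
    refine le_trans ?_ (norm_anglePow_sub_le hp (norm_natCast_le_one k) hs hpd)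
    have h1 := charEval_mul_anglePow_natCast hk d
    rw [if_neg hpd] at h1
    have e : ((d ^ (k - 1) : ℕ) : ℂ_[p]) - (d : ℂ_[p])⁻¹ *
        (charEval p (omegaPow p u) (d : ℤ_[p]) * anglePow p (d : ℤ_[p]) s) =
        (d : ℂ_[p])⁻¹ * charEval p (omegaPow p u) (d : ℤ_[p]) *
          (anglePow p (d : ℤ_[p]) (k : ℂ_[p]) - anglePow p (d : ℤ_[p]) s) := by
      have h2 : ((d ^ (k - 1) : ℕ) : ℂ_[p]) = (d : ℂ_[p])⁻¹ * (d : ℂ_[p]) ^ k := by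
        rw [eq_inv_mul_iff_mul_eq₀ hdp, Nat.cast_pow, ← pow_succ', Nat.sub_add_cancel
          (Nat.pos_of_ne_zero hk0)]
      rw [h2, ← h1]
      ring
    rw [e, norm_mul]
    refine mul_le_of_le_one_left (norm_nonneg _) ?_
    rw [norm_mul, norm_inv, norm_natCast_of_ne_zero p hd0, padicValNat.eq_zero_of_not_dvd hpd,
      pow_zero, inv_one, one_mul, charEval_omegaPow, norm_toCp]
    exact PadicInt.norm_le_one _
  · refine le_max_of_le_left ?_
    obtain ⟨c, hc'⟩ : p ∣ d := by
      by_contra h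
      exact hc ((Nat.Prime.coprime_iff_not_dvd Fact.out).mpr h)
    rw [sub_zero, Nat.cast_pow, norm_pow]
    refine pow_le_pow_left₀ (norm_nonneg _) ?_ _
    rw [hc', Nat.cast_mul, norm_mul, norm_p]
    exact mul_le_of_le_one_right (by positivity) (norm_natCast_le_one c)

end Limits

/-! ### Convergence along weight sequences, and their existence. -/

section Weights

variable {s : ℤ_[p]} {u : ZMod (p - 1)} {k : ℕ → ℕ}

theorem IsWeightSeq.tendsto_toCp (hk : IsWeightSeq s u k) :
    Tendsto (fun i => (k i : ℂ_[p])) atTop (𝓝 (toCp p s)) := by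
  have h := ((continuous_toCp p).tendsto s).comp ((continuous_fst.tendsto _).comp hk.weight)
  simpa [Function.comp_def] using h

theorem IsWeightSeq.eventually_eq (hk : IsWeightSeq s u k) :
    ∀ᶠ i in atTop, (k i : ZMod (p - 1)) = u := by
  have h := (continuous_snd.tendsto _).comp hk.weight
  rw [nhds_discrete, tendsto_pure] at h
  exact h

theorem IsWeightSeq.ne_zero (hk : IsWeightSeq s u k) (i : ℕ) : k i ≠ 0 := by
  have := hk.four_le i
  omega

theorem IsWeightSeq.tendsto_sub_one (hk : IsWeightSeq s u k) :
    Tendsto (fun i => k i - 1) atTop atTop :=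
  (tendsto_sub_atTop_nat 1).comp hk.tendsto_atTop

theorem norm_toCp_le_one (s : ℤ_[p]) : ‖toCp p s‖ ≤ 1 := by
  rw [norm_toCp]
  exact PadicInt.norm_le_one s

theorem IsWeightSeq.tendsto_constantCoeff (hp : p ≠ 2) (hk : IsWeightSeq s u k)
    (hsu : (s, u) ≠ (0, 0)) :
    Tendsto (fun i => ((-bernoulli (k i) / (2 * (k i : ℚ)) : ℚ) : ℂ_[p])) atTop
      (𝓝 (familyCoeff p (toCp p s) (omegaPow p u) 0 0)) := by
  have hs := norm_toCp_le_one s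
  have h0 : toCp p s ≠ 0 ∨ u ≠ 0 := by
    by_contra! h
    exact hsu (Prod.ext (toCp_eq_zero_iff.mp h.1) h.2)
  rw [familyCoeff, if_pos rfl, hurwitzZeta_one_sub hp hs h0]
  -- The pole term converges because either its denominator has a nonzero limit or its numerator is
  -- zero.
  have h1 : Tendsto (fun i => momentLim u 0 / (k i : ℂ_[p])) atTop
      (𝓝 (momentLim u 0 / toCp p s)) := by
    rcases h0 with h0 | h0
    · exact tendsto_const_nhds.div hk.tendsto_toCp h0
    · simp [momentLim_zero hp h0]
  have h2 : Tendsto (fun i => volkenbornQuot u (k i : ℂ_[p])) atTop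
      (𝓝 (volkenbornQuot u (toCp p s))) :=
    (continuousOn_volkenbornQuot hp u (toCp p s) hs).tendsto.comp
      (tendsto_nhdsWithin_iff.mpr ⟨hk.tendsto_toCp,
        Eventually.of_forall fun i => norm_natCast_le_one (k i)⟩)
  -- The Euler factor disappears because `k i → ∞` in the archimedean sense.
  have h3 : Tendsto (fun i => (1 - (p : ℂ_[p]) ^ (k i - 1))⁻¹) atTop (𝓝 1) := by
    have h4 : Tendsto (fun N : ℕ => (p : ℂ_[p]) ^ N) atTop (𝓝 0) :=
      tendsto_pow_atTop_nhds_zero_of_norm_lt_one (by rw [norm_p]; exact inv_p_lt_one)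
    simpa using ((h4.comp hk.tendsto_sub_one).const_sub 1).inv₀ (by simp)
  have h5 := ((h3.mul (h1.add h2).neg).const_mul (1 / 2 : ℂ_[p]))
  rw [one_mul] at h5
  refine h5.congr' ?_
  filter_upwards [hk.eventually_eq] with i hi
  have e1 := volkenbornSeries_natCast hp (hk.ne_zero i) hi
  rw [volkenbornSeries_eq hp u (norm_natCast_le_one _)] at e1
  have hk0 : (k i : ℂ_[p]) ≠ 0 := Nat.cast_ne_zero.mpr (hk.ne_zero i)
  have hpk : 1 - (p : ℂ_[p]) ^ (k i - 1) ≠ 0 := by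
    intro h
    have h' := congrArg norm (sub_eq_zero.mp h)
    rw [norm_one, norm_pow, norm_p] at h'
    have h4 := hk.four_le i
    exact (pow_lt_one₀ (by positivity) (inv_p_lt_one (p := p)) (by omega)).ne' h'
  push_cast
  field_simp
  linear_combination -e1

theorem coeff_classicalEisenstein (k n : ℕ) :
    ((PowerSeries.coeff n (classicalEisenstein k) : ℚ) : ℂ_[p]) =
      if n = 0 then ((-bernoulli k / (2 * (k : ℚ)) : ℚ) : ℂ_[p])
      else ((ArithmeticFunction.sigma (k - 1) n : ℕ) : ℂ_[p]) := by
  rw [classicalEisenstein, PowerSeries.coeff_mk]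
  split_ifs
  · rfl
  · exact Rat.cast_natCast _

theorem IsWeightSeq.tendstoUniformly (hp : p ≠ 2) (hk : IsWeightSeq s u k)
    (hsu : (s, u) ≠ (0, 0)) :
    TendstoUniformly
      (fun i n => ((PowerSeries.coeff n (classicalEisenstein (k i)) : ℚ) : ℂ_[p]))
      (fun n => PowerSeries.coeff n (family p (toCp p s) (omegaPow p u) 0)) atTop := by
  have hs := norm_toCp_le_one s
  rw [Metric.tendstoUniformly_iff]
  intro ε hε
  have h1 := (tendsto_pow_atTop_nhds_zero_of_lt_one (by positivity)
    (inv_p_lt_one (p := p))).comp hk.tendsto_sub_one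
  have h2 := tendsto_tsum_norm_choose_sub hp (fun i => norm_natCast_le_one (k i)) hs
    hk.tendsto_toCp
  filter_upwards [hk.eventually_eq, h1.eventually_lt_const hε, h2.eventually_lt_const hε,
    Metric.tendsto_nhds.mp (hk.tendsto_constantCoeff hp hsu) ε hε] with i hi hi1 hi2 hi0 n
  rw [dist_comm, family, PowerSeries.coeff_mk, coeff_classicalEisenstein]
  split_ifs with hn
  · rw [hn]
    exact hi0
  · rw [dist_eq_norm]
    exact (norm_sigma_sub_familyCoeff_le hp hs (hk.ne_zero i) hi hn).trans_lt (max_lt hi1 hi2)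

theorem exists_isWeightSeq (hp : p ≠ 2) (s : ℤ_[p]) {u : ZMod (p - 1)} (hu : Even u) :
    ∃ k, IsWeightSeq s u k := by
  have h3 : 3 ≤ p := by
    have := (Fact.out : p.Prime).two_le
    omega
  have : NeZero (p - 1) := ⟨by omega⟩
  -- Modulo `p^i` this is `s.appr i`. Modulo `p - 1` one has `p ≡ 1` and `p - 2 ≡ -1`, so the `appr`
  -- terms cancel and `u` remains; the last summand forces growth.
  let k (i : ℕ) : ℕ := s.appr i + p ^ i * (u.val + s.appr i * (p - 2) + (p - 1) * (i + 4))
  have hmod (i : ℕ) : (k i : ZMod (p - 1)) = u := by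
    have e2 : ((p - 1 : ℕ) : ZMod (p - 1)) = 0 := ZMod.natCast_self _
    have e1 : ((p : ℕ) : ZMod (p - 1)) = 1 := by
      have h : ((p - 1 + 1 : ℕ) : ZMod (p - 1)) = 1 := by
        rw [Nat.cast_add, e2, zero_add, Nat.cast_one]
      rwa [Nat.sub_add_cancel (by omega)] at h
    have e3 : ((p - 2 : ℕ) : ZMod (p - 1)) = -1 := by
      rw [eq_neg_iff_add_eq_zero, ← e2, show p - 1 = p - 2 + 1 by omega]
      simp
    simp only [k]
    rw [Nat.cast_add, Nat.cast_mul, Nat.cast_add, Nat.cast_add, Nat.cast_mul, Nat.cast_mul,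
      Nat.cast_pow, e1, e2, e3, ZMod.natCast_zmod_val]
    ring
  have hge (i : ℕ) : i + 4 ≤ k i := by
    have h4 : i + 4 ≤ (p - 1) * (i + 4) := Nat.le_mul_of_pos_left _ (by omega)
    have h5 := Nat.le_mul_of_pos_left
      (u.val + s.appr i * (p - 2) + (p - 1) * (i + 4)) (pow_pos (show 0 < p by omega) i)
    simp only [k]
    omega
  refine ⟨k, fun i => by have := hge i; omega, fun i => ?_, ?_, ?_⟩
  · obtain ⟨r, hr⟩ := hu
    obtain ⟨m, hm⟩ := (Fact.out : p.Prime).odd_of_ne_two hp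
    have h4 : (k i : ZMod (p - 1)) = ((r.val + r.val : ℕ) : ZMod (p - 1)) := by
      rw [hmod, hr, Nat.cast_add, ZMod.natCast_zmod_val]
    rw [ZMod.natCast_eq_natCast_iff] at h4
    -- Since `p - 1` is even, the congruence modulo `p - 1` determines parity.
    have h5 : k i ≡ r.val + r.val [MOD 2] := h4.of_dvd ⟨m, by omega⟩
    rw [Nat.even_iff]
    have h6 : k i % 2 = (r.val + r.val) % 2 := h5
    omega
  · exact tendsto_atTop_mono (fun i => (Nat.le_add_right i 4).trans (hge i)) tendsto_id
  · rw [nhds_prod_eq]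
    refine Tendsto.prodMk ?_ (by simp only [hmod]; exact tendsto_const_nhds)
    rw [tendsto_iff_norm_sub_tendsto_zero]
    refine squeeze_zero (fun _ => norm_nonneg _) (fun i => ?_)
      (tendsto_pow_atTop_nhds_zero_of_lt_one (by positivity) (inv_p_lt_one (p := p)))
    have hd : (p : ℤ_[p]) ^ i ∣ (k i : ℤ_[p]) - s := by
      have h4 := Ideal.mem_span_singleton.mp (PadicInt.appr_spec i s)
      have e : (k i : ℤ_[p]) - s = p ^ i * ((u.val + s.appr i * (p - 2) + (p - 1) * (i + 4) : ℕ) :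
          ℤ_[p]) - (s - s.appr i) := by
        simp only [k]
        rw [Nat.cast_add, Nat.cast_mul, Nat.cast_pow]
        ring
      rw [e]
      exact dvd_sub (dvd_mul_right _ _) h4
    simpa only [norm_toCp] using norm_toCp_le_of_dvd hd

end Weights

theorem isSerreEisenstein_family (hp : p ≠ 2) {s : ℤ_[p]} {u : ZMod (p - 1)} (hu : Even u)
    (hsu : (s, u) ≠ (0, 0)) : IsSerreEisenstein s u (family p (toCp p s) (omegaPow p u) 0) :=
  ⟨exists_isWeightSeq hp s hu, fun _ hk => hk.tendstoUniformly hp hsu⟩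

end PadicEisenstein

theorem proposition3p5 (p : ℕ) [Fact p.Prime] (hp : p ≠ 2)
    (s : ℤ_[p]) (u : ZMod (p - 1)) (hu : Even u) (hsu : (s, u) ≠ (0, 0)) :
    PadicEisenstein.IsSerreEisenstein s u (PadicEisenstein.serreEisenstein p s u) ∧
      PadicEisenstein.family p (PadicEisenstein.toCp p s) (PadicEisenstein.omegaPow p u) 0 =
        PadicEisenstein.serreEisenstein p s u := by
  have h := PadicEisenstein.isSerreEisenstein_family hp hu hsu
  have h' : PadicEisenstein.IsSerreEisenstein s u (PadicEisenstein.serreEisenstein p s u) :=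
    Classical.epsilon_spec ⟨_, h⟩
  exact ⟨h', h.unique h'⟩
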